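/- Let $r\ge 1$ and $n$ be natural numbers, let $u,v$ be unit vectors in $\mathbb{R}^n$ (Euclidean norm $\|\cdot\|$, standard inner product $u\cdot v$), and let $Z\in\mathbb{R}^{r\times n}$ be a random matrix whose entries are independent and distributed according to the standard normal distribution $N(0,1)$. Then $Zu\neq 0$ and $Zv\ne 0$ almost surely, the random variable $\frac{Zu}{\|Zu\|}\cdot\frac{Zv}{\|Zv\|}$ is integrable, and $$\mathbb{E}\left[\frac{Zu}{\|Zu\|}\cdot\frac{Zv}{\|Zv\|}\right]=\frac{2}{r}\left(\frac{\Gamma((r+1)/2)}{\Gamma(r/2)}\right)^2 (u\cdot v)\;{}_2F_1\!\left(\tfrac12,\tfrac12;\tfrac r2+1;(u\cdot v)^2\right),$$ where $\Gamma$ is the Gamma function and ${}_2F_1(a,b;c;x)=\sum_{k\ge 0}\frac{(a)_k(b)_k}{(c)_k}\frac{x^k}{k!}$, with $(a)_k=a(a+1)\cdots(a+k-1)$, is the Gaussian hypergeometric function. Moreover $$(u\cdot v)\;{}_2F_1\!\left(\tfrac12,\tfrac12;\tfrac r2+1;(u\cdot v)^2\right)=\sum_{k=0}^{\infty}\frac{(1\cdot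 3\cdots(2k-1))^2}{(2\cdot 4\cdots 2k)\,((r+2)(r+4)\cdots(r+2k))}\,(u\cdot v)^{2k+1},$$ where the series converges and empty products are equal to $1$. -/

import Mathlib

open MeasureTheory ProbabilityTheory

/-- A random `r × n` matrix whose entries are independent standard normal random variables. -/
structure IsStdGaussianMatrix {Ω : Type*} [MeasurableSpace Ω] {r n : ℕ}
    (Z : Ω → Matrix (Fin r) (Fin n) ℝ) (P : Measure Ω) : Prop where
  hasLaw_entry : ∀ i j, HasLaw (fun ω => Z ω i j) (gaussianReal 0 1) P
  indep : iIndepFun (fun (ij : Fin r × Fin n) (ω : Ω) => Z ω ij.1 ij.2) P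

/-- The matrix-vector product `A u`, with values in Euclidean space. -/
noncomputable def matVec {r n : ℕ} (A : Matrix (Fin r) (Fin n) ℝ)
    (u : EuclideanSpace ℝ (Fin n)) : EuclideanSpace ℝ (Fin r) :=
  WithLp.toLp 2 (A.mulVec u.ofLp)

/-- The normalized vector `A u / ‖A u‖` (Euclidean norm; equal to `0` if `A u = 0`). -/
noncomputable def normalizedMatVec {r n : ℕ} (A : Matrix (Fin r) (Fin n) ℝ)
    (u : EuclideanSpace ℝ (Fin n)) : EuclideanSpace ℝ (Fin r) :=
  ‖matVec A u‖⁻¹ • matVec A u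

/-! Write `t` for `u · v`. Only the rows `(⟨u, Zᵢ⟩, ⟨v, Zᵢ⟩)` matter; they are i.i.d. with law
`corrGaussian t`, and the random variable is the cosine `pairCos` of the two coordinate vectors.
Each inverse norm is linearised by `1/√N = (2π)^(-1/2) ∫ s^(-1/2) exp(-sN/2) ds` over `s > 0`. After
Fubini the Gaussian expectation factorises over rows: with `D = (1+s)(1+w) - t²sw`, one row
contributes `t D^(-3/2)` and the others `D^(-1/2)` each, so the expectation is `r t / (2π)` times
the integral of `s^(-1/2) w^(-1/2) D^(-(r/2+1))` over the quadrant (`integral_pairKernel_pi`,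
`integral_pairCos`). Expanding `D^(-c)` in powers of `t²` gives nonnegative terms, each a product of
two beta integrals (`lintegral_corrKernel`), and `corrCoeff_eq` identifies the coefficients.
Convergence, even at `t² = 1`, follows from `|pairCos| ≤ 1` through Fubini. -/

/-- The centred Gaussian measure on `ℝ × ℝ` with unit variances and correlation `t`. -/
noncomputable def corrGaussian (t : ℝ) : Measure (ℝ × ℝ) :=
  ((gaussianReal 0 1).prod (gaussianReal 0 1)).map
    (fun p => (p.1, t * p.1 + √(1 - t ^ 2) * p.2))

instance isProbabilityMeasure_corrGaussian (t : ℝ) : IsProbabilityMeasure (corrGaussian t) :=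
  Measure.isProbabilityMeasure_map (by fun_prop)

/-! ### Joint law of the rows -/

/-- The pair of linear forms `z ↦ (⟨u, z⟩, ⟨v, z⟩)`. -/
noncomputable def dotPair {ι : Type*} [Fintype ι] (u v : ι → ℝ) : (ι → ℝ) →L[ℝ] ℝ × ℝ :=
  (∑ j, u j • ContinuousLinearMap.proj (R := ℝ) (φ := fun _ => ℝ) j).prod
    (∑ j, v j • ContinuousLinearMap.proj (R := ℝ) (φ := fun _ => ℝ) j)

lemma dotPair_apply {ι : Type*} [Fintype ι] (u v z : ι → ℝ) :
    dotPair u v z = (∑ j, u j * z j, ∑ j, v j * z j) := by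
  simp [dotPair]

lemma charFunDual_gaussianReal_std (L : StrongDual ℝ ℝ) :
    charFunDual (gaussianReal 0 1) L = Complex.exp (-((L 1 : ℝ) : ℂ) ^ 2 / 2) := by
  rw [charFunDual_apply]
  have h := charFun_gaussianReal (μ := 0) (v := 1) (L 1)
  rw [charFun_apply_real] at h
  convert h using 2
  · ext x
    have : L x = x * L 1 := by
      conv_lhs => rw [← mul_one x, ← smul_eq_mul, map_smul, smul_eq_mul]
    rw [this]; push_cast; ring_nf
  · push_cast; ring_nf

/-- Both characteristic functions are exponentials of a quadratic form in `L (1, 0)` and `L (0, 1)`;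
the hypotheses on `u` and `v` make the two forms equal. -/
lemma pi_gaussianReal_map_dotPair {ι : Type*} [Fintype ι] (u v : ι → ℝ) (t : ℝ)
    (hu : ∑ j, u j ^ 2 = 1) (hv : ∑ j, v j ^ 2 = 1) (ht : ∑ j, u j * v j = t) (ht1 : t ^ 2 ≤ 1) :
    (Measure.pi fun _ : ι => gaussianReal 0 1).map (dotPair u v) = corrGaussian t := by
  classical
  let M : ℝ × ℝ →L[ℝ] ℝ × ℝ := (ContinuousLinearMap.fst ℝ ℝ ℝ).prod
    (t • ContinuousLinearMap.fst ℝ ℝ ℝ + √(1 - t ^ 2) • ContinuousLinearMap.snd ℝ ℝ ℝ)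
  have hM : corrGaussian t = ((gaussianReal 0 1).prod (gaussianReal 0 1)).map M := by
    unfold corrGaussian
    congr 1
  have hL (L : StrongDual ℝ (ℝ × ℝ)) (a b : ℝ) : L (a, b) = a * L (1, 0) + b * L (0, 1) := by
    have : ((a, b) : ℝ × ℝ) = a • (1, 0) + b • (0, 1) := by simp
    rw [this, map_add, map_smul, map_smul, smul_eq_mul, smul_eq_mul]
  have : IsProbabilityMeasure
      ((Measure.pi fun _ : ι => gaussianReal 0 1).map (dotPair u v)) :=
    Measure.isProbabilityMeasure_map (by fun_prop)
  apply Measure.ext_of_charFunDual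
  ext L
  rw [hM, charFunDual_map, charFunDual_map, charFunDual_pi, charFunDual_prod]
  simp_rw [charFunDual_gaussianReal_std]
  rw [← Complex.exp_sum, ← Complex.exp_add]
  have h1 : ∀ j, ((L ∘L dotPair u v) ∘L ContinuousLinearMap.single ℝ (fun _ : ι => ℝ) j) 1
      = u j * L (1, 0) + v j * L (0, 1) := by
    intro j
    simp only [ContinuousLinearMap.comp_apply, ContinuousLinearMap.single_apply, dotPair_apply]
    rw [hL]
    simp [Pi.single_apply]
  have h2 : (L ∘L M) (1, 0) = L (1, 0) + t * L (0, 1) := by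
    simp only [M, ContinuousLinearMap.comp_apply]
    simp only [ContinuousLinearMap.prod_apply]
    rw [hL]; simp
  have h3 : (L ∘L M) (0, 1) = √(1 - t ^ 2) * L (0, 1) := by
    simp only [M, ContinuousLinearMap.comp_apply]
    simp only [ContinuousLinearMap.prod_apply]
    rw [hL]; simp
  have hs : √(1 - t ^ 2) ^ 2 = 1 - t ^ 2 := Real.sq_sqrt (by linarith)
  congr 1
  simp_rw [h1]
  simp only [ContinuousLinearMap.comp_apply (g := L ∘L M), ContinuousLinearMap.inl_apply,
    ContinuousLinearMap.inr_apply, h2, h3]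
  norm_cast
  rw [← Finset.sum_div, ← add_div]
  congr 1
  rw [mul_pow, hs]
  have e : ∑ j, (u j * L (1, 0) + v j * L (0, 1)) ^ 2 = (∑ j, u j ^ 2) * L (1, 0) ^ 2 +
      2 * (∑ j, u j * v j) * (L (1, 0) * L (0, 1)) + (∑ j, v j ^ 2) * L (0, 1) ^ 2 := by
    simp_rw [Finset.mul_sum, Finset.sum_mul, ← Finset.sum_add_distrib]
    exact Finset.sum_congr rfl fun j _ => by ring
  rw [Finset.sum_neg_distrib, e, hu, hv, ht]
  ring

lemma hasLaw_pi_pi_of_iIndepFun {Ω ι κ : Type*} [MeasurableSpace Ω] {P : Measure Ω}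
    [Fintype ι] [Fintype κ] {Z : Ω → ι → κ → ℝ} {μ : Measure ℝ} [IsProbabilityMeasure μ]
    (hZ : ∀ i j, HasLaw (fun ω => Z ω i j) μ P)
    (hind : iIndepFun (fun (ij : ι × κ) (ω : Ω) => Z ω ij.1 ij.2) P) :
    HasLaw Z (Measure.pi fun _ => Measure.pi fun _ => μ) P := by
  have h1 : HasLaw (fun ω (ij : ι × κ) => Z ω ij.1 ij.2) (Measure.pi fun _ => μ) P :=
    hind.hasLaw_pi fun ij => hZ ij.1 ij.2
  -- The coordinate process under `Q` has the same uncurried law as `Z`; currying both transfers the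
  -- law back to `Z`.
  let Q : Measure (ι → κ → ℝ) := Measure.pi fun _ => Measure.pi fun _ => μ
  have hev (i : ι) (j : κ) : HasLaw (fun x : ι → κ → ℝ => x i j) μ Q :=
    ((measurePreserving_eval (fun _ : κ => μ) j).comp
      (measurePreserving_eval (fun _ : ι => Measure.pi fun _ : κ => μ) i)).hasLaw
  have h2 : iIndepFun (fun (p : ι × κ) (x : ι → κ → ℝ) => x p.1 p.2) Q := by
    apply iIndepFun_uncurry' (X := fun i j (x : ι → κ → ℝ) => x i j) (by fun_prop)
    · exact iIndepFun_pi (X := fun _ (y : κ → ℝ) => y) (fun _ => by fun_prop)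
    · intro i
      rw [iIndepFun_iff_map_fun_eq_pi_map fun j => (hev i j).aemeasurable]
      simp_rw [fun j => (hev i j).map_eq]
      exact (measurePreserving_eval (fun _ : ι => Measure.pi fun _ : κ => μ) i).map_eq
  have h3 : HasLaw (fun (x : ι → κ → ℝ) (ij : ι × κ) => x ij.1 ij.2) (Measure.pi fun _ => μ) Q :=
    h2.hasLaw_pi fun ij => hev ij.1 ij.2
  have hc : Measurable fun (y : ι × κ → ℝ) i j => y (i, j) := by fun_prop
  refine ⟨?_, ?_⟩
  · exact hc.comp_aemeasurable h1.aemeasurable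
  · have e1 := AEMeasurable.map_map_of_aemeasurable hc.aemeasurable h1.aemeasurable
    have e2 := AEMeasurable.map_map_of_aemeasurable hc.aemeasurable h3.aemeasurable
    rw [h1.map_eq] at e1
    rw [h3.map_eq, e1] at e2
    simpa [Function.comp_def] using e2

lemma hasLaw_pi_corrGaussian {Ω ι κ : Type*} [MeasurableSpace Ω] {P : Measure Ω}
    [Fintype ι] [Fintype κ] {Z : Ω → ι → κ → ℝ}
    (hZ : ∀ i j, HasLaw (fun ω => Z ω i j) (gaussianReal 0 1) P)
    (hind : iIndepFun (fun (ij : ι × κ) (ω : Ω) => Z ω ij.1 ij.2) P) (u v : κ → ℝ) (t : ℝ)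
    (hu : ∑ j, u j ^ 2 = 1) (hv : ∑ j, v j ^ 2 = 1) (ht : ∑ j, u j * v j = t) (ht1 : t ^ 2 ≤ 1) :
    HasLaw (fun ω i => (∑ j, u j * Z ω i j, ∑ j, v j * Z ω i j))
      (Measure.pi fun _ : ι => corrGaussian t) P := by
  have h := hasLaw_pi_pi_of_iIndepFun hZ hind
  have e : ∀ i : ι, IsProbabilityMeasure
      ((Measure.pi fun _ : κ => gaussianReal 0 1).map (dotPair u v)) := fun _ =>
    Measure.isProbabilityMeasure_map (by fun_prop)
  have h2 : HasLaw (fun (x : ι → κ → ℝ) i => dotPair u v (x i))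
      (Measure.pi fun _ : ι => corrGaussian t)
      (Measure.pi fun _ : ι => Measure.pi fun _ : κ => gaussianReal 0 1) := by
    refine ⟨Measurable.aemeasurable (measurable_pi_lambda _ fun i =>
      (dotPair u v).continuous.measurable.comp (measurable_pi_apply i)), ?_⟩
    rw [← pi_gaussianReal_map_dotPair u v t hu hv ht ht1, Measure.pi_map_pi (by fun_prop)]
  have h3 := h2.comp h
  simpa only [Function.comp_def, dotPair_apply] using h3

/-! ### Gaussian integrals with quadratic exponential weights -/

/-- Completing the square: the weight tilts the standard density into a multiple of another Gaussian
density, which reduces the weighted integrals below to known moments. -/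
lemma exp_mul_gaussianPDFReal_std {w : ℝ} (hw : 0 ≤ w) (m c y : ℝ) :
    gaussianPDFReal 0 1 y * Real.exp (-(w * (m + c * y) ^ 2 / 2)) =
      ((1 + w * c ^ 2) ^ (-(1 / 2) : ℝ) * Real.exp (-(w / (1 + w * c ^ 2) * m ^ 2 / 2))) *
        gaussianPDFReal (-(w * m * c) / (1 + w * c ^ 2))
          (Real.toNNReal (1 / (1 + w * c ^ 2))) y := by
  have ha : 0 < 1 + w * c ^ 2 := by positivity
  rw [gaussianPDFReal, gaussianPDFReal, Real.coe_toNNReal _ (by positivity), Real.rpow_neg ha.le,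
    ← Real.sqrt_eq_rpow]
  have h1 : √(2 * Real.pi * (1 / (1 + w * c ^ 2))) =
      √(2 * Real.pi) * (√(1 + w * c ^ 2))⁻¹ := by
    rw [Real.sqrt_mul (by positivity), one_div, Real.sqrt_inv]
  have h2 : -(y - 0) ^ 2 / (2 * ((1 : NNReal) : ℝ)) + -(w * (m + c * y) ^ 2 / 2) =
      -(w / (1 + w * c ^ 2) * m ^ 2 / 2) +
        -(y - -(w * m * c) / (1 + w * c ^ 2)) ^ 2 / (2 * (1 / (1 + w * c ^ 2))) := by
    push_cast
    field_simp
    ring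
  have h3 : √(1 + w * c ^ 2) ≠ 0 := by positivity
  calc _ = (√(2 * Real.pi))⁻¹ * (Real.exp (-(y - 0) ^ 2 / (2 * ((1 : NNReal) : ℝ))) *
        Real.exp (-(w * (m + c * y) ^ 2 / 2))) := by simp; ring
    _ = _ := by
      rw [← Real.exp_add, h2, Real.exp_add, h1, mul_inv, inv_inv]
      field_simp

lemma integral_mul_exp_gaussianReal_std {w : ℝ} (hw : 0 ≤ w) (m c : ℝ) (f : ℝ → ℝ) :
    ∫ y, f y * Real.exp (-(w * (m + c * y) ^ 2 / 2)) ∂gaussianReal 0 1 =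
      ((1 + w * c ^ 2) ^ (-(1 / 2) : ℝ) * Real.exp (-(w / (1 + w * c ^ 2) * m ^ 2 / 2))) *
        ∫ y, f y ∂gaussianReal (-(w * m * c) / (1 + w * c ^ 2))
          (Real.toNNReal (1 / (1 + w * c ^ 2))) := by
  have ha : 0 < 1 + w * c ^ 2 := by positivity
  rw [integral_gaussianReal_eq_integral_smul one_ne_zero,
    integral_gaussianReal_eq_integral_smul (by simpa using ha), ← integral_const_mul]
  refine integral_congr_ae (.of_forall fun y => ?_)
  simp only [smul_eq_mul]
  have := exp_mul_gaussianPDFReal_std hw m c y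
  linear_combination f y * this

lemma integral_exp_gaussianReal_std {w : ℝ} (hw : 0 ≤ w) (m c : ℝ) :
    ∫ y, Real.exp (-(w * (m + c * y) ^ 2 / 2)) ∂gaussianReal 0 1 =
      (1 + w * c ^ 2) ^ (-(1 / 2) : ℝ) * Real.exp (-(w / (1 + w * c ^ 2) * m ^ 2 / 2)) := by
  simpa using integral_mul_exp_gaussianReal_std hw m c fun _ => 1

lemma integral_affine_mul_exp_gaussianReal_std {w : ℝ} (hw : 0 ≤ w) (m c : ℝ) :
    ∫ y, (m + c * y) * Real.exp (-(w * (m + c * y) ^ 2 / 2)) ∂gaussianReal 0 1 =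
      (1 + w * c ^ 2) ^ (-(3 / 2) : ℝ) * m *
        Real.exp (-(w / (1 + w * c ^ 2) * m ^ 2 / 2)) := by
  have ha : 0 < 1 + w * c ^ 2 := by positivity
  rw [integral_mul_exp_gaussianReal_std hw m c fun y => m + c * y]
  have hi : Integrable (fun y : ℝ => y) (gaussianReal (-(w * m * c) / (1 + w * c ^ 2))
      (Real.toNNReal (1 / (1 + w * c ^ 2)))) :=
    (memLp_id_gaussianReal' 1 (by simp)).integrable le_rfl
  rw [integral_add (by fun_prop) (hi.const_mul c), integral_const_mul, integral_id_gaussianReal]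
  have h : (1 + w * c ^ 2) ^ (-(3 / 2) : ℝ) =
      (1 + w * c ^ 2) ^ (-(1 / 2) : ℝ) * (1 + w * c ^ 2)⁻¹ := by
    rw [← Real.rpow_neg_one, ← Real.rpow_add ha]; norm_num
  rw [h]
  simp
  field_simp
  ring

lemma integral_sq_mul_exp_gaussianReal_std {b : ℝ} (hb : 0 ≤ b) :
    ∫ x, x ^ 2 * Real.exp (-(b * x ^ 2 / 2)) ∂gaussianReal 0 1 = (1 + b) ^ (-(3 / 2) : ℝ) := by
  have ha : 0 < 1 + b := by positivity
  have h := integral_mul_exp_gaussianReal_std hb 0 1 fun x => x ^ 2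
  simp only [zero_add, one_mul, one_pow, mul_one, mul_zero, neg_zero, zero_div] at h
  rw [h]
  have hv := variance_fun_id_gaussianReal (μ := 0) (v := Real.toNNReal (1 / (1 + b)))
  rw [variance_eq_integral (by fun_prop), integral_id_gaussianReal] at hv
  simp only [sub_zero] at hv
  have e : (1 + b) ^ (-(3 / 2) : ℝ) = (1 + b) ^ (-(1 / 2) : ℝ) * (1 + b)⁻¹ := by
    rw [← Real.rpow_neg_one, ← Real.rpow_add ha]; norm_num
  rw [hv, Real.coe_toNNReal _ (by positivity), e]
  simp

/-- The determinant of `1 + Σ diag(s, w)`, with `Σ` the covariance matrix of `corrGaussian t`. -/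
noncomputable def corrDet (t s w : ℝ) : ℝ := (1 + s) * (1 + w) - t ^ 2 * (s * w)

/-- The two factors on the left come from integrating out the second Gaussian coordinate, then the
first. -/
lemma corrDet_eq {t : ℝ} (ht : t ^ 2 ≤ 1) (s : ℝ) {w : ℝ} (hw : 0 ≤ w) :
    (1 + w * √(1 - t ^ 2) ^ 2) * (1 + (s + w / (1 + w * √(1 - t ^ 2) ^ 2) * t ^ 2)) =
      corrDet t s w := by
  have ha : 0 < 1 + w * √(1 - t ^ 2) ^ 2 := by positivity
  rw [corrDet]
  field_simp
  rw [Real.sq_sqrt (by linarith)]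
  ring

lemma measurable_corrGaussian_map (t : ℝ) :
    Measurable fun p : ℝ × ℝ => (p.1, t * p.1 + √(1 - t ^ 2) * p.2) := by fun_prop

lemma integral_exp_corrGaussian {t s w : ℝ} (ht : t ^ 2 ≤ 1) (hs : 0 ≤ s) (hw : 0 ≤ w) :
    ∫ p, Real.exp (-(s * p.1 ^ 2 / 2) - w * p.2 ^ 2 / 2) ∂corrGaussian t =
      corrDet t s w ^ (-(1 / 2) : ℝ) := by
  have ha : 0 < 1 + w * √(1 - t ^ 2) ^ 2 := by positivity
  rw [corrGaussian, integral_map (measurable_corrGaussian_map t).aemeasurable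
    (by fun_prop), integral_prod]
  · have h1 (x : ℝ) : ∫ y, Real.exp (-(s * x ^ 2 / 2) - w * (t * x + √(1 - t ^ 2) * y) ^ 2 / 2)
        ∂gaussianReal 0 1 = (1 + w * √(1 - t ^ 2) ^ 2) ^ (-(1 / 2) : ℝ) *
          Real.exp (-((s + w / (1 + w * √(1 - t ^ 2) ^ 2) * t ^ 2) * (0 + 1 * x) ^ 2 / 2)) := by
      simp_rw [sub_eq_add_neg (-(s * x ^ 2 / 2)), Real.exp_add]
      rw [integral_const_mul, integral_exp_gaussianReal_std hw, mul_left_comm, ← Real.exp_add]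
      ring_nf
    simp_rw [h1]
    rw [integral_const_mul, integral_exp_gaussianReal_std (by positivity), ← corrDet_eq ht s hw,
      Real.mul_rpow (by positivity) (by positivity)]
    simp
  · refine Integrable.of_bound (by fun_prop) 1 (.of_forall fun p => ?_)
    rw [Real.norm_eq_abs, Real.abs_exp, Real.exp_le_one_iff]
    have : 0 ≤ s * p.1 ^ 2 / 2 := by positivity
    have : 0 ≤ w * (t * p.1 + √(1 - t ^ 2) * p.2) ^ 2 / 2 := by positivity
    simp only; linarith

lemma integrable_mul_corrGaussian (t : ℝ) : Integrable (fun p => p.1 * p.2) (corrGaussian t) := by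
  have h1 : MemLp (fun p : ℝ × ℝ => p.1) 2 ((gaussianReal 0 1).prod (gaussianReal 0 1)) :=
    (memLp_id_gaussianReal' 2 (by simp)).comp_measurePreserving measurePreserving_fst
  have h2 : MemLp (fun p : ℝ × ℝ => p.2) 2 ((gaussianReal 0 1).prod (gaussianReal 0 1)) :=
    (memLp_id_gaussianReal' 2 (by simp)).comp_measurePreserving measurePreserving_snd
  rw [corrGaussian, integrable_map_measure (by fun_prop) (by fun_prop)]
  exact h1.integrable_mul ((h1.const_mul t).add (h2.const_mul _))

lemma integral_mul_exp_corrGaussian {t s w : ℝ} (ht : t ^ 2 ≤ 1) (hs : 0 ≤ s) (hw : 0 ≤ w) :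
    ∫ p, p.1 * p.2 * Real.exp (-(s * p.1 ^ 2 / 2) - w * p.2 ^ 2 / 2) ∂corrGaussian t =
      t * corrDet t s w ^ (-(3 / 2) : ℝ) := by
  have ha : 0 < 1 + w * √(1 - t ^ 2) ^ 2 := by positivity
  have hint : Integrable (fun p : ℝ × ℝ => p.1 * p.2 *
      Real.exp (-(s * p.1 ^ 2 / 2) - w * p.2 ^ 2 / 2)) (corrGaussian t) := by
    refine (integrable_mul_corrGaussian t).mul_bdd (c := 1) (by fun_prop) (.of_forall fun p => ?_)
    rw [Real.norm_eq_abs, Real.abs_exp, Real.exp_le_one_iff]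
    have : 0 ≤ s * p.1 ^ 2 / 2 := by positivity
    have : 0 ≤ w * p.2 ^ 2 / 2 := by positivity
    linarith
  rw [corrGaussian, integrable_map_measure (by fun_prop) (by fun_prop)] at hint
  rw [corrGaussian, integral_map (measurable_corrGaussian_map t).aemeasurable
    (by fun_prop)]
  refine (integral_prod _ hint).trans ?_
  simp only [Function.comp_def]
  have h1 (x : ℝ) : ∫ y, x * (t * x + √(1 - t ^ 2) * y) *
      Real.exp (-(s * x ^ 2 / 2) - w * (t * x + √(1 - t ^ 2) * y) ^ 2 / 2)
      ∂gaussianReal 0 1 = ((1 + w * √(1 - t ^ 2) ^ 2) ^ (-(3 / 2) : ℝ) * t) *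
        (x ^ 2 * Real.exp (-((s + w / (1 + w * √(1 - t ^ 2) ^ 2) * t ^ 2) * x ^ 2 / 2))) := by
    have e : -((s + w / (1 + w * √(1 - t ^ 2) ^ 2) * t ^ 2) * x ^ 2 / 2) =
        -(s * x ^ 2 / 2) + -(w / (1 + w * √(1 - t ^ 2) ^ 2) * (t * x) ^ 2 / 2) := by ring
    rw [e, Real.exp_add]
    simp_rw [sub_eq_add_neg (-(s * x ^ 2 / 2)), Real.exp_add]
    calc _ = ∫ y, (x * Real.exp (-(s * x ^ 2 / 2))) * ((t * x + √(1 - t ^ 2) * y) *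
          Real.exp (-(w * (t * x + √(1 - t ^ 2) * y) ^ 2 / 2))) ∂gaussianReal 0 1 :=
          integral_congr_ae (.of_forall fun y => by ring)
      _ = _ := by
        rw [integral_const_mul, integral_affine_mul_exp_gaussianReal_std hw]
        ring
  simp_rw [h1]
  rw [integral_const_mul, integral_sq_mul_exp_gaussianReal_std (by positivity),
    ← corrDet_eq ht s hw, Real.mul_rpow (by positivity) (by positivity)]
  ring

lemma ae_fst_ne_zero_corrGaussian (t : ℝ) : ∀ᵐ p ∂corrGaussian t, p.1 ≠ 0 := by
  have hm : MeasurableSet {p : ℝ × ℝ | p.1 ≠ 0} :=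
    (measurableSet_eq_fun measurable_fst measurable_const).compl
  rw [corrGaussian, ae_map_iff (by fun_prop) hm]
  have := nullSingletonClass_gaussianReal (μ := 0) (v := 1) one_ne_zero
  have h : ∀ᵐ x ∂gaussianReal 0 1, x ≠ (0 : ℝ) := by
    rw [ae_iff]; simp
  exact Measure.quasiMeasurePreserving_fst.ae h

/-! ### Gamma and beta integrals, negative binomial series -/

lemma lintegral_rpow_mul_exp_neg_mul_Ioi {a b : ℝ} (ha : 0 < a) (hb : 0 < b) :
    ∫⁻ x in Set.Ioi (0 : ℝ), ENNReal.ofReal (x ^ (a - 1) * Real.exp (-(b * x))) =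
      ENNReal.ofReal (b ^ (-a) * Real.Gamma a) := by
  have h := Real.integral_rpow_mul_exp_neg_mul_Ioi ha hb
  rw [one_div, Real.inv_rpow hb.le, ← Real.rpow_neg hb.le] at h
  have hpos : 0 < b ^ (-a) * Real.Gamma a := by positivity
  rw [← h, ofReal_integral_eq_lintegral_ofReal]
  -- A non-integrable function has integral `0` by convention, contradicting the positive value.
  · by_contra hn
    rw [integral_undef hn] at h
    exact hpos.ne h
  · filter_upwards [ae_restrict_mem measurableSet_Ioi] with x hx
    have : (0 : ℝ) < x := hx
    positivity

/-- The beta integral: `Γ(a+d) (1+s)^(-(a+d))` is written as a gamma integral and Tonelli swaps the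
order. -/
lemma lintegral_rpow_mul_one_add_rpow_Ioi {a d : ℝ} (ha : 0 < a) (hd : 0 < d) :
    ∫⁻ s in Set.Ioi (0 : ℝ), ENNReal.ofReal (s ^ (a - 1) * (1 + s) ^ (-(a + d))) =
      ENNReal.ofReal (Real.Gamma a * Real.Gamma d / Real.Gamma (a + d)) := by
  have hG : 0 < Real.Gamma (a + d) := by positivity
  have h1 : ∀ s ∈ Set.Ioi (0 : ℝ), ENNReal.ofReal (Real.Gamma (a + d)) *
      ENNReal.ofReal (s ^ (a - 1) * (1 + s) ^ (-(a + d))) =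
      ∫⁻ x in Set.Ioi (0 : ℝ),
        ENNReal.ofReal (s ^ (a - 1) * (x ^ (a + d - 1) * Real.exp (-((1 + s) * x)))) := by
    intro s hs
    have hs : 0 < s := hs
    simp_rw [ENNReal.ofReal_mul (show 0 ≤ s ^ (a - 1) by positivity)]
    rw [lintegral_const_mul _ (by fun_prop),
      lintegral_rpow_mul_exp_neg_mul_Ioi (by positivity) (by positivity),
      ← ENNReal.ofReal_mul (by positivity), ← ENNReal.ofReal_mul (by positivity),
      ← ENNReal.ofReal_mul (by positivity)]
    congr 1
    ring
  have h2 : ∀ x ∈ Set.Ioi (0 : ℝ), ∫⁻ s in Set.Ioi (0 : ℝ),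
        ENNReal.ofReal (s ^ (a - 1) * (x ^ (a + d - 1) * Real.exp (-((1 + s) * x)))) =
      ENNReal.ofReal (Real.Gamma a) * ENNReal.ofReal (x ^ (d - 1) * Real.exp (-(1 * x))) := by
    intro x hx
    have hx : 0 < x := hx
    have e : ∀ s : ℝ, s ^ (a - 1) * (x ^ (a + d - 1) * Real.exp (-((1 + s) * x))) =
        (x ^ (a + d - 1) * Real.exp (-x)) * (s ^ (a - 1) * Real.exp (-(x * s))) := by
      intro s
      rw [show -((1 + s) * x) = -x + -(x * s) by ring, Real.exp_add]
      ring
    simp_rw [e, ENNReal.ofReal_mul (show 0 ≤ x ^ (a + d - 1) * Real.exp (-x) by positivity)]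
    rw [lintegral_const_mul _ (by fun_prop), lintegral_rpow_mul_exp_neg_mul_Ioi ha hx,
      ← ENNReal.ofReal_mul (by positivity), ← ENNReal.ofReal_mul (by positivity)]
    congr 1
    rw [show d - 1 = (a + d - 1) + -a by ring, Real.rpow_add hx, one_mul]
    ring
  have key : ENNReal.ofReal (Real.Gamma (a + d)) *
      ∫⁻ s in Set.Ioi (0 : ℝ), ENNReal.ofReal (s ^ (a - 1) * (1 + s) ^ (-(a + d))) =
      ENNReal.ofReal (Real.Gamma a * Real.Gamma d) := by
    rw [← lintegral_const_mul _ (by fun_prop), setLIntegral_congr_fun measurableSet_Ioi h1,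
      lintegral_lintegral_swap (by fun_prop), setLIntegral_congr_fun measurableSet_Ioi h2,
      lintegral_const_mul _ (by fun_prop), lintegral_rpow_mul_exp_neg_mul_Ioi hd one_pos,
      ← ENNReal.ofReal_mul (by positivity)]
    simp
  rw [ENNReal.ofReal_div_of_pos hG, ← key, mul_comm, ENNReal.mul_div_cancel_right
    (by simpa using hG) (by simp)]

/-- In `Γ(c) (A-B)^(-c) = ∫ x^(c-1) exp(-Ax) exp(Bx) dx`, the factor `exp(Bx)` is expanded and
integrated termwise. -/
lemma ofReal_sub_rpow_neg_eq_tsum {A B c : ℝ} (hB : 0 ≤ B) (hAB : B < A) (hc : 0 < c) :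
    ENNReal.ofReal ((A - B) ^ (-c)) = ∑' k : ℕ, ENNReal.ofReal
      (Real.Gamma (c + k) / (Real.Gamma c * k.factorial) * (B ^ k * A ^ (-(c + k)))) := by
  have hA : 0 < A := hB.trans_lt hAB
  have hG : 0 < Real.Gamma c := by positivity
  have h0 := lintegral_rpow_mul_exp_neg_mul_Ioi hc (sub_pos.2 hAB)
  have h1 : ∀ x ∈ Set.Ioi (0 : ℝ),
      ENNReal.ofReal (x ^ (c - 1) * Real.exp (-((A - B) * x))) =
      ∑' k : ℕ, ENNReal.ofReal (B ^ k / k.factorial *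
        (x ^ (c + k - 1) * Real.exp (-(A * x)))) := by
    intro x hx
    have hx : 0 < x := hx
    have hs := (NormedSpace.expSeries_div_hasSum_exp (B * x)).mul_left
      (x ^ (c - 1) * Real.exp (-(A * x)))
    rw [← Real.exp_eq_exp_ℝ, mul_assoc, ← Real.exp_add,
      show -(A * x) + B * x = -((A - B) * x) by ring] at hs
    rw [← hs.tsum_eq, ENNReal.ofReal_tsum_of_nonneg (fun k => by positivity) hs.summable]
    refine tsum_congr fun k => ?_
    congr 1
    rw [show c + k - 1 = (c - 1) + k by ring, Real.rpow_add hx, Real.rpow_natCast, mul_pow]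
    ring
  rw [setLIntegral_congr_fun measurableSet_Ioi h1, lintegral_tsum (fun k => by fun_prop)] at h0
  have h2 : ∀ k : ℕ, ∫⁻ x in Set.Ioi (0 : ℝ), ENNReal.ofReal (B ^ k / k.factorial *
        (x ^ (c + k - 1) * Real.exp (-(A * x)))) = ENNReal.ofReal (Real.Gamma c) *
      ENNReal.ofReal (Real.Gamma (c + k) / (Real.Gamma c * k.factorial) *
        (B ^ k * A ^ (-(c + k)))) := by
    intro k
    simp_rw [ENNReal.ofReal_mul (show 0 ≤ B ^ k / k.factorial by positivity)]
    rw [lintegral_const_mul _ (by fun_prop),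
      lintegral_rpow_mul_exp_neg_mul_Ioi (by positivity) hA,
      ← ENNReal.ofReal_mul (by positivity), ← ENNReal.ofReal_mul (by positivity)]
    congr 1
    field_simp
  simp_rw [h2] at h0
  rw [ENNReal.tsum_mul_left, mul_comm (_ ^ (-c)), ENNReal.ofReal_mul hG.le] at h0
  exact ((ENNReal.mul_right_inj (by simpa using hG) (by simp)).1 h0).symm

/-! ### Quadrant integral as a power series -/

/-- The density `s ^ (-1/2) w ^ (-1/2) corrDet t s w ^ (-c)` on the first quadrant. -/
noncomputable def corrKernel (c t : ℝ) (q : ℝ × ℝ) : ℝ :=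
  q.1 ^ (-(1 / 2) : ℝ) * q.2 ^ (-(1 / 2) : ℝ) * corrDet t q.1 q.2 ^ (-c)

/-- The coefficients of the integral of `corrKernel c t` as a power series in `t ^ 2`. -/
noncomputable def corrCoeff (c : ℝ) (k : ℕ) : ℝ :=
  Real.Gamma (c + k) / (Real.Gamma c * k.factorial) *
    (Real.Gamma (k + 1 / 2) * Real.Gamma (c - 1 / 2) / Real.Gamma (c + k)) ^ 2

/-- Lebesgue measure on the open first quadrant. -/
noncomputable def quadrant : Measure (ℝ × ℝ) :=
  (volume.restrict (Set.Ioi 0)).prod (volume.restrict (Set.Ioi 0))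

instance sFinite_quadrant : SFinite quadrant := by unfold quadrant; infer_instance

lemma ae_quadrant_pos : ∀ᵐ q ∂quadrant, 0 < q.1 ∧ 0 < q.2 := by
  rw [quadrant, Measure.prod_restrict]
  filter_upwards [ae_restrict_mem (measurableSet_Ioi.prod measurableSet_Ioi)] with q hq
  exact hq

lemma corrCoeff_nonneg {c : ℝ} (hc : 1 / 2 < c) (k : ℕ) : 0 ≤ corrCoeff c k := by
  have : 0 < c - 1 / 2 := by linarith
  have : 0 < c := by linarith
  unfold corrCoeff
  positivity

lemma corrDet_pos {t s w : ℝ} (ht : t ^ 2 ≤ 1) (hs : 0 < s) (hw : 0 < w) :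
    0 < corrDet t s w := by
  rw [corrDet]
  have : t ^ 2 * (s * w) ≤ 1 * (s * w) := by gcongr
  nlinarith

/-- The binomial series with `A = (1+s)(1+w)` and `B = t²sw` has terms that separate in `s` and `w`.
Working in `ENNReal` requires no prior convergence. -/
lemma lintegral_corrKernel {c t : ℝ} (hc : 1 / 2 < c) (ht : t ^ 2 ≤ 1) :
    ∫⁻ q, ENNReal.ofReal (corrKernel c t q) ∂quadrant =
      ∑' k : ℕ, ENNReal.ofReal (corrCoeff c k * (t ^ 2) ^ k) := by
  have hc0 : 0 < c := by linarith
  have hc1 : 0 < c - 1 / 2 := by linarith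
  have h1 : ∀ᵐ q ∂quadrant, ENNReal.ofReal (corrKernel c t q) =
      ∑' k : ℕ, ENNReal.ofReal (Real.Gamma (c + k) / (Real.Gamma c * k.factorial) * (t ^ 2) ^ k) *
        (ENNReal.ofReal (q.1 ^ (((k : ℝ) + 1 / 2) - 1) *
            (1 + q.1) ^ (-(((k : ℝ) + 1 / 2) + (c - 1 / 2)))) *
          ENNReal.ofReal (q.2 ^ (((k : ℝ) + 1 / 2) - 1) *
            (1 + q.2) ^ (-(((k : ℝ) + 1 / 2) + (c - 1 / 2))))) := by
    filter_upwards [ae_quadrant_pos] with q hq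
    obtain ⟨hs, hw⟩ := hq
    have hlt : t ^ 2 * (q.1 * q.2) < (1 + q.1) * (1 + q.2) := by
      have := corrDet_pos ht hs hw
      rw [corrDet] at this
      linarith
    rw [corrKernel, corrDet, ENNReal.ofReal_mul (by positivity),
      ofReal_sub_rpow_neg_eq_tsum (by positivity) hlt hc0, ← ENNReal.tsum_mul_left]
    refine tsum_congr fun k => ?_
    rw [← ENNReal.ofReal_mul (by positivity), ← ENNReal.ofReal_mul (by positivity),
      ← ENNReal.ofReal_mul (by positivity)]
    congr 1
    have e1 : (k : ℝ) + 1 / 2 - 1 = -(1 / 2) + k := by ring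
    have e2 : -((k : ℝ) + 1 / 2 + (c - 1 / 2)) = -(c + k) := by ring
    rw [e1, e2, Real.rpow_add hs, Real.rpow_add hw, Real.rpow_natCast, Real.rpow_natCast,
      Real.mul_rpow (by positivity) (by positivity), mul_pow, mul_pow]
    ring
  rw [lintegral_congr_ae h1, lintegral_tsum (fun k => by fun_prop)]
  refine tsum_congr fun k => ?_
  let g (x : ℝ) : ENNReal := ENNReal.ofReal (x ^ (((k : ℝ) + 1 / 2) - 1) *
    (1 + x) ^ (-(((k : ℝ) + 1 / 2) + (c - 1 / 2))))
  have hg : Measurable g := by fun_prop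
  rw [lintegral_const_mul _ (by fun_prop), quadrant,
    lintegral_prod_mul (f := g) (g := g) hg.aemeasurable hg.aemeasurable,
    lintegral_rpow_mul_one_add_rpow_Ioi (by positivity) hc1,
    ← ENNReal.ofReal_mul (by positivity), ← ENNReal.ofReal_mul (by positivity), corrCoeff]
  congr 1
  rw [show (k : ℝ) + 1 / 2 + (c - 1 / 2) = c + k by ring]
  ring

lemma hasSum_corrCoeff {c t : ℝ} (hc : 1 / 2 < c) (ht : t ^ 2 ≤ 1)
    (hint : Integrable (corrKernel c t) quadrant) :
    HasSum (fun k : ℕ => corrCoeff c k * (t ^ 2) ^ k) (∫ q, corrKernel c t q ∂quadrant) := by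
  have hnn : ∀ k : ℕ, 0 ≤ corrCoeff c k * (t ^ 2) ^ k := fun k =>
    mul_nonneg (corrCoeff_nonneg hc k) (by positivity)
  have h0 : 0 ≤ᵐ[quadrant] corrKernel c t := by
    filter_upwards [ae_quadrant_pos] with q hq
    have := corrDet_pos ht hq.1 hq.2
    have := hq.1
    have := hq.2
    simp only [corrKernel, Pi.zero_apply]
    positivity
  have h1 := lintegral_corrKernel hc ht
  rw [← ofReal_integral_eq_lintegral_ofReal hint h0] at h1
  have hs : Summable fun k : ℕ => corrCoeff c k * (t ^ 2) ^ k := by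
    refine (ENNReal.summable_toReal (h1 ▸ ENNReal.ofReal_ne_top)).congr fun k => ?_
    exact ENNReal.toReal_ofReal (hnn k)
  rw [← ENNReal.ofReal_tsum_of_nonneg hnn hs,
    ENNReal.ofReal_eq_ofReal_iff (integral_nonneg_of_ae h0) (tsum_nonneg hnn)] at h1
  exact h1 ▸ hs.hasSum

/-! ### Identification of the hypergeometric coefficients -/

lemma Gamma_add_nat_eq_ascPochhammer {a : ℝ} (ha : 0 < a) (k : ℕ) :
    Real.Gamma (a + k) = (ascPochhammer ℝ k).eval a * Real.Gamma a := by
  induction k with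
  | zero => simp
  | succ k ih =>
    rw [ascPochhammer_succ_eval, Nat.cast_succ, ← add_assoc,
      Real.Gamma_add_one (by positivity), ih]
    ring

lemma corrCoeff_eq {r : ℝ} (hr : 0 < r) (k : ℕ) :
    r / (2 * Real.pi) * corrCoeff (r / 2 + 1) k =
      2 / r * (Real.Gamma ((r + 1) / 2) / Real.Gamma (r / 2)) ^ 2 *
        ((k.factorial : ℝ)⁻¹ * (ascPochhammer ℝ k).eval (1 / 2) *
          (ascPochhammer ℝ k).eval (1 / 2) * ((ascPochhammer ℝ k).eval (r / 2 + 1))⁻¹) := by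
  have hp : 0 < (ascPochhammer ℝ k).eval (r / 2 + 1) := ascPochhammer_pos _ _ (by positivity)
  have hG : 0 < Real.Gamma (r / 2) := by positivity
  rw [corrCoeff, Gamma_add_nat_eq_ascPochhammer (by positivity), add_comm (k : ℝ),
    Gamma_add_nat_eq_ascPochhammer (by positivity), Real.Gamma_add_one (by positivity),
    show r / 2 + 1 - 1 / 2 = (r + 1) / 2 by ring, Real.Gamma_one_half_eq]
  have : √Real.pi ^ 2 = Real.pi := Real.sq_sqrt Real.pi_pos.le
  field_simp
  rw [this]
  ring

lemma prod_two_mul_add_one_eq (k : ℕ) :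
    ∏ i ∈ Finset.range k, (2 * (i : ℝ) + 1) = 2 ^ k * (ascPochhammer ℝ k).eval (1 / 2) := by
  induction k with
  | zero => simp
  | succ k ih => rw [Finset.prod_range_succ, ih, ascPochhammer_succ_eval]; ring

lemma prod_two_mul_add_two_eq (k : ℕ) :
    ∏ i ∈ Finset.range k, (2 * ((i : ℝ) + 1)) = 2 ^ k * k.factorial := by
  induction k with
  | zero => simp
  | succ k ih => rw [Finset.prod_range_succ, ih, Nat.factorial_succ]; push_cast; ring

lemma prod_add_two_mul_eq (r : ℝ) (k : ℕ) :
    ∏ i ∈ Finset.range k, (r + 2 * ((i : ℝ) + 1)) =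
      2 ^ k * (ascPochhammer ℝ k).eval (r / 2 + 1) := by
  induction k with
  | zero => simp
  | succ k ih => rw [Finset.prod_range_succ, ih, ascPochhammer_succ_eval]; ring

lemma hypergeometric_term_eq (r t : ℝ) (k : ℕ) :
    (∏ i ∈ Finset.range k, (2 * (i : ℝ) + 1)) ^ 2 /
        ((∏ i ∈ Finset.range k, (2 * ((i : ℝ) + 1))) *
          ∏ i ∈ Finset.range k, (r + 2 * ((i : ℝ) + 1))) * t ^ (2 * k + 1) =
      t * (((k.factorial : ℝ)⁻¹ * (ascPochhammer ℝ k).eval (1 / 2) *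
          (ascPochhammer ℝ k).eval (1 / 2) * ((ascPochhammer ℝ k).eval (r / 2 + 1))⁻¹) *
          (t ^ 2) ^ k) := by
  rw [prod_two_mul_add_one_eq, prod_two_mul_add_two_eq, prod_add_two_mul_eq, pow_succ t, pow_mul]
  have : (k.factorial : ℝ) ≠ 0 := by positivity
  field_simp

/-! ### The cosine as a quadrant integral, and its expectation -/

lemma integrable_rpow_mul_exp_half {N : ℝ} (hN : 0 < N) :
    IntegrableOn (fun s : ℝ => s ^ (-(1 / 2) : ℝ) * Real.exp (-(s * N / 2))) (Set.Ioi 0) ∧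
      ∫ s in Set.Ioi (0 : ℝ), s ^ (-(1 / 2) : ℝ) * Real.exp (-(s * N / 2)) =
        √(2 * Real.pi) / √N := by
  have h := Real.integral_rpow_mul_exp_neg_mul_Ioi (a := 1 / 2) (r := N / 2) (by norm_num)
    (by positivity)
  have e : ∀ s : ℝ, s ^ ((1 / 2 : ℝ) - 1) * Real.exp (-(N / 2 * s)) =
      s ^ (-(1 / 2) : ℝ) * Real.exp (-(s * N / 2)) := by
    intro s
    rw [show (1 / 2 : ℝ) - 1 = -(1 / 2) by norm_num, show N / 2 * s = s * N / 2 by ring]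
  simp_rw [e] at h
  have hv : (1 / (N / 2)) ^ (1 / 2 : ℝ) * Real.Gamma (1 / 2) = √(2 * Real.pi) / √N := by
    rw [Real.Gamma_one_half_eq, ← Real.sqrt_eq_rpow, one_div_div, Real.sqrt_div (by norm_num),
      Real.sqrt_mul (by norm_num)]
    ring
  rw [hv] at h
  refine ⟨?_, h⟩
  by_contra hn
  rw [integral_undef hn] at h
  have : 0 < √(2 * Real.pi) / √N := by positivity
  exact this.ne h

section

variable {ι : Type*} [Fintype ι]

/-- The cosine of the angle between the vectors of first and of second coordinates. -/
noncomputable def pairCos (x : ι → ℝ × ℝ) : ℝ :=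
  (∑ i, (x i).1 * (x i).2) / (√(∑ i, (x i).1 ^ 2) * √(∑ i, (x i).2 ^ 2))

/-- The integrand whose integral over the quadrant is `2 π` times `pairCos`. -/
noncomputable def pairKernel (x : ι → ℝ × ℝ) (q : ℝ × ℝ) : ℝ :=
  (∑ i, (x i).1 * (x i).2) *
    ((q.1 ^ (-(1 / 2) : ℝ) * Real.exp (-(q.1 * (∑ i, (x i).1 ^ 2) / 2))) *
      (q.2 ^ (-(1 / 2) : ℝ) * Real.exp (-(q.2 * (∑ i, (x i).2 ^ 2) / 2))))

@[fun_prop]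
lemma measurable_pairCos : Measurable (pairCos (ι := ι)) := by
  unfold pairCos
  fun_prop

lemma abs_pairCos_le_one (x : ι → ℝ × ℝ) : |pairCos x| ≤ 1 := by
  have hnn : 0 ≤ √(∑ i, (x i).1 ^ 2) * √(∑ i, (x i).2 ^ 2) := by positivity
  rw [pairCos, abs_div, abs_of_nonneg hnn]
  refine div_le_one_of_le₀ ?_ (by positivity)
  rw [← Real.sqrt_mul (by positivity), ← Real.sqrt_sq_eq_abs]
  exact Real.sqrt_le_sqrt (Finset.sum_mul_sq_le_sq_mul_sq _ _ _)

lemma integrable_pairKernel_quadrant (x : ι → ℝ × ℝ) :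
    Integrable (pairKernel x) quadrant ∧
      (∫ q, pairKernel x q ∂quadrant) = 2 * Real.pi * pairCos x := by
  -- If a coordinate vector vanishes, the numerator is zero and both sides are `0`.
  by_cases h1 : ∀ i, (x i).1 = 0
  · have h : pairKernel x = 0 := by ext q; simp [pairKernel, h1]
    simp [h, pairCos, h1]
  by_cases h2 : ∀ i, (x i).2 = 0
  · have h : pairKernel x = 0 := by ext q; simp [pairKernel, h2]
    simp [h, pairCos, h2]
  push Not at h1 h2
  obtain ⟨i, hi⟩ := h1
  obtain ⟨j, hj⟩ := h2
  have hN1 : 0 < ∑ i, (x i).1 ^ 2 :=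
    Finset.sum_pos' (fun _ _ => sq_nonneg _) ⟨i, Finset.mem_univ _, by positivity⟩
  have hN2 : 0 < ∑ i, (x i).2 ^ 2 :=
    Finset.sum_pos' (fun _ _ => sq_nonneg _) ⟨j, Finset.mem_univ _, by positivity⟩
  obtain ⟨i1, e1⟩ := integrable_rpow_mul_exp_half hN1
  obtain ⟨i2, e2⟩ := integrable_rpow_mul_exp_half hN2
  refine ⟨(i1.mul_prod i2).const_mul _, ?_⟩
  simp only [pairKernel]
  rw [integral_const_mul, quadrant,
    integral_prod_mul (fun s : ℝ => s ^ (-(1 / 2) : ℝ) * Real.exp (-(s * (∑ i, (x i).1 ^ 2) / 2)))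
      (fun s : ℝ => s ^ (-(1 / 2) : ℝ) * Real.exp (-(s * (∑ i, (x i).2 ^ 2) / 2))), e1, e2, pairCos]
  have : √(2 * Real.pi) ^ 2 = 2 * Real.pi := Real.sq_sqrt (by positivity)
  field_simp
  rw [this]
  ring

/-- On the quadrant the kernel keeps the sign of `∑ i, (x i).1 * (x i).2`, which does not depend on
`q`. -/
lemma integral_norm_pairKernel (x : ι → ℝ × ℝ) :
    ∫ q, ‖pairKernel x q‖ ∂quadrant = 2 * Real.pi * |pairCos x| := by
  have hK := (integrable_pairKernel_quadrant x).2
  rcases le_total 0 (∑ i, (x i).1 * (x i).2) with h | h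
  · have e : ∀ᵐ q ∂quadrant, ‖pairKernel x q‖ = pairKernel x q := by
      filter_upwards [ae_quadrant_pos] with q hq
      have := hq.1
      have := hq.2
      exact Real.norm_of_nonneg (mul_nonneg h (by positivity))
    rw [integral_congr_ae e, hK,
      abs_of_nonneg (show 0 ≤ pairCos x from div_nonneg h (by positivity))]
  · have e : ∀ᵐ q ∂quadrant, ‖pairKernel x q‖ = -pairKernel x q := by
      filter_upwards [ae_quadrant_pos] with q hq
      have := hq.1
      have := hq.2
      exact Real.norm_of_nonpos (mul_nonpos_of_nonpos_of_nonneg h (by positivity))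
    rw [integral_congr_ae e, integral_neg, hK,
      abs_of_nonpos (show pairCos x ≤ 0 from div_nonpos_of_nonpos_of_nonneg h (by positivity))]
    ring

lemma integrable_pairCos (t : ℝ) :
    Integrable (pairCos (ι := ι)) (Measure.pi fun _ => corrGaussian t) :=
  Integrable.of_bound (by fun_prop) 1 (.of_forall abs_pairCos_le_one)

lemma integrable_pairKernel (t : ℝ) :
    Integrable (fun z : (ι → ℝ × ℝ) × (ℝ × ℝ) => pairKernel z.1 z.2)
      ((Measure.pi fun _ => corrGaussian t).prod quadrant) := by
  rw [integrable_prod_iff (by unfold pairKernel; fun_prop)]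
  refine ⟨.of_forall fun x => (integrable_pairKernel_quadrant x).1, ?_⟩
  simp_rw [integral_norm_pairKernel]
  exact (integrable_pairCos t).abs.const_mul _

lemma integral_pairKernel_pi {t : ℝ} (ht : t ^ 2 ≤ 1) {q : ℝ × ℝ} (h1 : 0 < q.1) (h2 : 0 < q.2) :
    ∫ x : ι → ℝ × ℝ, pairKernel x q ∂(Measure.pi fun _ => corrGaussian t) =
      Fintype.card ι * t * corrKernel (Fintype.card ι / 2 + 1) t q := by
  classical
  have hD := corrDet_pos ht h1 h2
  let e (p : ℝ × ℝ) : ℝ := Real.exp (-(q.1 * p.1 ^ 2 / 2) - q.2 * p.2 ^ 2 / 2)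
  -- The exponential is a product over coordinates; in the `i`-th summand only the factor `j = i`
  -- carries `p.1 * p.2`.
  let f (i j : ι) (p : ℝ × ℝ) : ℝ := (if j = i then p.1 * p.2 else 1) * e p
  have hf (x : ι → ℝ × ℝ) : pairKernel x q =
      q.1 ^ (-(1 / 2) : ℝ) * q.2 ^ (-(1 / 2) : ℝ) * ∑ i, ∏ j, f i j (x j) := by
    have hprod (i : ι) : ∏ j, f i j (x j) = (x i).1 * (x i).2 * ∏ j, e (x j) := by
      simp only [f]
      rw [Finset.prod_mul_distrib, Finset.prod_ite_eq' Finset.univ i]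
      simp
    simp_rw [hprod]
    rw [← Finset.sum_mul, ← Real.exp_sum, Finset.sum_sub_distrib, Finset.sum_neg_distrib,
      sub_eq_add_neg, Real.exp_add, ← Finset.sum_div, ← Finset.sum_div, ← Finset.mul_sum,
      ← Finset.mul_sum, pairKernel]
    ring
  have he : ∀ p, ‖e p‖ ≤ 1 := by
    intro p
    rw [Real.norm_eq_abs, Real.abs_exp, Real.exp_le_one_iff]
    have : 0 ≤ q.1 * p.1 ^ 2 / 2 := by positivity
    have : 0 ≤ q.2 * p.2 ^ 2 / 2 := by positivity
    linarith
  have hem : Measurable e := by fun_prop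
  have hfi (i j : ι) : Integrable (f i j) (corrGaussian t) := by
    by_cases hij : j = i
    · simp only [f, hij, if_true]
      exact (integrable_mul_corrGaussian t).mul_bdd hem.aestronglyMeasurable (.of_forall he)
    · simp only [f, hij, if_false, one_mul]
      exact .of_bound hem.aestronglyMeasurable 1 (.of_forall he)
  have hfv (i j : ι) : ∫ p, f i j p ∂corrGaussian t =
      (if j = i then t * (corrDet t q.1 q.2)⁻¹ else 1) * corrDet t q.1 q.2 ^ (-(1 / 2) : ℝ) := by
    by_cases hij : j = i
    · simp only [f, hij, if_true, e]
      rw [integral_mul_exp_corrGaussian ht h1.le h2.le, mul_assoc, ← Real.rpow_neg_one,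
        ← Real.rpow_add hD]
      norm_num
    · simp only [f, hij, if_false, one_mul, e]
      exact integral_exp_corrGaussian ht h1.le h2.le
  simp_rw [hf]
  rw [integral_const_mul, integral_finsetSum _ fun i _ => Integrable.fintype_prod (hfi i)]
  simp_rw [integral_fintype_prod_eq_prod, hfv, Finset.prod_mul_distrib]
  simp only [Finset.prod_ite_eq', Finset.mem_univ, if_true, Finset.prod_const, Finset.card_univ,
    Finset.sum_const, nsmul_eq_mul]
  rw [corrKernel, ← Real.rpow_natCast, ← Real.rpow_mul hD.le,
    show -((Fintype.card ι : ℝ) / 2 + 1) = -1 + -(1 / 2) * (Fintype.card ι : ℝ) by ring,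
    Real.rpow_add hD, Real.rpow_neg_one]
  ring

/-- No estimate of the kernel is needed: up to the factor `card ι * t` it is a marginal of the
integrable `pairKernel`. Dividing by that factor requires `t ≠ 0`. -/
lemma integrable_corrKernel [Nonempty ι] {t : ℝ} (ht : t ^ 2 ≤ 1) (ht0 : t ≠ 0) :
    Integrable (corrKernel (Fintype.card ι / 2 + 1) t) quadrant := by
  have h := (integrable_pairKernel (ι := ι) t).integral_prod_right
  have h2 : Integrable (fun q => (Fintype.card ι * t : ℝ) *
      corrKernel (Fintype.card ι / 2 + 1) t q) quadrant := by
    refine h.congr ?_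
    filter_upwards [ae_quadrant_pos] with q hq
    exact integral_pairKernel_pi ht hq.1 hq.2
  have hne : (Fintype.card ι * t : ℝ) ≠ 0 := mul_ne_zero (by simp) ht0
  exact (integrable_const_mul_iff (IsUnit.mk0 _ hne) _).1 h2

lemma integral_pairCos {t : ℝ} (ht : t ^ 2 ≤ 1) :
    ∫ x : ι → ℝ × ℝ, pairCos x ∂(Measure.pi fun _ => corrGaussian t) =
      t * (Fintype.card ι / (2 * Real.pi) *
        ∫ q, corrKernel (Fintype.card ι / 2 + 1) t q ∂quadrant) := by
  have h := integral_integral_swap (f := pairKernel) (integrable_pairKernel (ι := ι) t)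
  simp_rw [fun x : ι → ℝ × ℝ => (integrable_pairKernel_quadrant x).2] at h
  rw [integral_const_mul, integral_congr_ae (g := fun q => (Fintype.card ι * t : ℝ) *
      corrKernel (Fintype.card ι / 2 + 1) t q)
    (by filter_upwards [ae_quadrant_pos] with q hq using integral_pairKernel_pi ht hq.1 hq.2),
    integral_const_mul] at h
  have hpi := Real.pi_ne_zero
  rw [← mul_right_inj' (show 2 * Real.pi ≠ 0 by positivity), h]
  generalize (∫ q, corrKernel (Fintype.card ι / 2 + 1) t q ∂quadrant) = K
  field_simp

end

/-! ### Assembly -/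

lemma hasSum_hypergeometric_and_integral_pairCos {r : ℕ} (hr : 1 ≤ r) {t : ℝ} (ht : t ^ 2 ≤ 1) :
    (∫ x : Fin r → ℝ × ℝ, pairCos x ∂(Measure.pi fun _ => corrGaussian t) =
      (2 / (r : ℝ)) * (Real.Gamma (((r : ℝ) + 1) / 2) / Real.Gamma ((r : ℝ) / 2)) ^ 2 *
        (t * ₂F₁ (1 / 2 : ℝ) (1 / 2 : ℝ) ((r : ℝ) / 2 + 1) (t ^ 2))) ∧
    HasSum
      (fun k : ℕ =>
        (∏ i ∈ Finset.range k, (2 * (i : ℝ) + 1)) ^ 2 /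
          ((∏ i ∈ Finset.range k, (2 * ((i : ℝ) + 1))) *
            ∏ i ∈ Finset.range k, ((r : ℝ) + 2 * ((i : ℝ) + 1))) * t ^ (2 * k + 1))
      (t * ₂F₁ (1 / 2 : ℝ) (1 / 2 : ℝ) ((r : ℝ) / 2 + 1) (t ^ 2)) := by
  have hr0 : (0 : ℝ) < r := by exact_mod_cast hr
  have : Nonempty (Fin r) := ⟨⟨0, hr⟩⟩
  have hI := integral_pairCos (ι := Fin r) ht
  rw [Fintype.card_fin] at hI
  simp_rw [hypergeometric_term_eq]
  -- At `t = 0` integrability of the kernel is not at hand, but the prefactor `t` kills everything.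
  rcases eq_or_ne t 0 with rfl | ht0
  · simp [hI]
  have hK := integrable_corrKernel (ι := Fin r) ht ht0
  rw [Fintype.card_fin] at hK
  have hS := (hasSum_corrCoeff (by linarith) ht hK).mul_left ((r : ℝ) / (2 * Real.pi))
  simp_rw [← mul_assoc ((r : ℝ) / (2 * Real.pi)), corrCoeff_eq hr0] at hS
  set C := (2 / (r : ℝ)) * (Real.Gamma (((r : ℝ) + 1) / 2) / Real.Gamma ((r : ℝ) / 2)) ^ 2
  have hC : C ≠ 0 := by positivity
  have hF : HasSum (fun k : ℕ => ((k.factorial : ℝ)⁻¹ * (ascPochhammer ℝ k).eval (1 / 2) *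
      (ascPochhammer ℝ k).eval (1 / 2) * ((ascPochhammer ℝ k).eval ((r : ℝ) / 2 + 1))⁻¹) *
      (t ^ 2) ^ k) (₂F₁ (1 / 2 : ℝ) (1 / 2 : ℝ) ((r : ℝ) / 2 + 1) (t ^ 2)) := by
    rw [ordinaryHypergeometric_eq_tsum]
    refine Summable.hasSum ?_
    refine (summable_mul_left_iff hC).1 (hS.summable.congr fun k => ?_)
    ring
  refine ⟨?_, hF.mul_left t⟩
  rw [hI, hS.unique ((hF.mul_left C).congr_fun fun k => by ring)]
  ring

/-- Valid for every `A`, since both sides are `0` when a norm vanishes. -/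
lemma inner_normalizedMatVec {r n : ℕ} (A : Matrix (Fin r) (Fin n) ℝ)
    (u v : EuclideanSpace ℝ (Fin n)) :
    inner ℝ (normalizedMatVec A u) (normalizedMatVec A v) =
      pairCos fun i => (∑ j, u j * A i j, ∑ j, v j * A i j) := by
  have h (w : EuclideanSpace ℝ (Fin n)) (i : Fin r) : matVec A w i = ∑ j, w j * A i j := by
    simp [matVec, Matrix.mulVec, dotProduct, mul_comm]
  rw [normalizedMatVec, normalizedMatVec, real_inner_smul_left, real_inner_smul_right, pairCos,
    EuclideanSpace.norm_eq, EuclideanSpace.norm_eq, PiLp.inner_apply]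
  simp only [h, Real.norm_eq_abs, sq_abs, RCLike.inner_apply, conj_trivial]
  rw [div_eq_mul_inv, mul_inv]
  simp_rw [mul_comm (∑ j, v j * A _ j)]
  ring

lemma IsStdGaussianMatrix.hasLaw_rows {Ω : Type*} [MeasurableSpace Ω] {P : Measure Ω} {r n : ℕ}
    {Z : Ω → Matrix (Fin r) (Fin n) ℝ} (hZ : IsStdGaussianMatrix Z P)
    {u v : EuclideanSpace ℝ (Fin n)} (hu : ‖u‖ = 1) (hv : ‖v‖ = 1) :
    HasLaw (fun ω i => (∑ j, u j * Z ω i j, ∑ j, v j * Z ω i j))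
      (Measure.pi fun _ : Fin r => corrGaussian (inner ℝ u v)) P := by
  refine hasLaw_pi_corrGaussian hZ.hasLaw_entry hZ.indep u.ofLp v.ofLp _ ?_ ?_ ?_ ?_
  · rw [← EuclideanSpace.real_norm_sq_eq, hu, one_pow]
  · rw [← EuclideanSpace.real_norm_sq_eq, hv, one_pow]
  · simp [PiLp.inner_apply, mul_comm]
  · rw [sq_le_one_iff_abs_le_one]
    simpa [hu, hv] using abs_real_inner_le_norm u v

lemma IsStdGaussianMatrix.ae_matVec_ne_zero {Ω : Type*} [MeasurableSpace Ω] {P : Measure Ω}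
    {r n : ℕ} (hr : 1 ≤ r) {Z : Ω → Matrix (Fin r) (Fin n) ℝ} (hZ : IsStdGaussianMatrix Z P)
    {u : EuclideanSpace ℝ (Fin n)} (hu : ‖u‖ = 1) : ∀ᵐ ω ∂P, matVec (Z ω) u ≠ 0 := by
  -- Taking `v = u` suffices: only the first coordinate, a standard Gaussian without atoms, is used.
  have hlaw := hZ.hasLaw_rows hu hu
  let i : Fin r := ⟨0, hr⟩
  have h1 : ∀ᵐ x ∂(Measure.pi fun _ : Fin r => corrGaussian (inner ℝ u u)), (x i).1 ≠ 0 :=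
    (measurePreserving_eval (fun _ : Fin r => corrGaussian (inner ℝ u u))
      i).quasiMeasurePreserving.ae
      (ae_fst_ne_zero_corrGaussian _)
  rw [← hlaw.map_eq] at h1
  filter_upwards [ae_of_ae_map hlaw.aemeasurable h1] with ω hω h0
  apply hω
  have := congrArg (fun y : EuclideanSpace ℝ (Fin r) => y i) h0
  simpa [matVec, Matrix.mulVec, dotProduct, mul_comm] using this

theorem lemma2p1 {Ω : Type*} [MeasurableSpace Ω] (P : Measure Ω) [IsProbabilityMeasure P]
    (r n : ℕ) (hr : 1 ≤ r)
    (Z : Ω → Matrix (Fin r) (Fin n) ℝ) (hZ : IsStdGaussianMatrix Z P)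
    (u v : EuclideanSpace ℝ (Fin n)) (hu : ‖u‖ = 1) (hv : ‖v‖ = 1) :
    (∀ᵐ ω ∂P, matVec (Z ω) u ≠ 0 ∧ matVec (Z ω) v ≠ 0) ∧
    Integrable (fun ω => inner ℝ (normalizedMatVec (Z ω) u) (normalizedMatVec (Z ω) v)) P ∧
    ∫ ω, inner ℝ (normalizedMatVec (Z ω) u) (normalizedMatVec (Z ω) v) ∂P =
      (2 / (r : ℝ)) * (Real.Gamma (((r : ℝ) + 1) / 2) / Real.Gamma ((r : ℝ) / 2)) ^ 2 *
        (inner ℝ u v * ₂F₁ (1 / 2 : ℝ) (1 / 2 : ℝ) ((r : ℝ) / 2 + 1) ((inner ℝ u v : ℝ) ^ 2)) ∧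
    HasSum
      (fun k : ℕ =>
        (∏ i ∈ Finset.range k, (2 * (i : ℝ) + 1)) ^ 2 /
          ((∏ i ∈ Finset.range k, (2 * ((i : ℝ) + 1))) *
            ∏ i ∈ Finset.range k, ((r : ℝ) + 2 * ((i : ℝ) + 1))) *
          (inner ℝ u v : ℝ) ^ (2 * k + 1))
      (inner ℝ u v * ₂F₁ (1 / 2 : ℝ) (1 / 2 : ℝ) ((r : ℝ) / 2 + 1) ((inner ℝ u v : ℝ) ^ 2)) := by
  have hlaw := hZ.hasLaw_rows hu hv
  have ht : (inner ℝ u v : ℝ) ^ 2 ≤ 1 := by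
    rw [sq_le_one_iff_abs_le_one]
    simpa [hu, hv] using abs_real_inner_le_norm u v
  obtain ⟨hint, hsum⟩ := hasSum_hypergeometric_and_integral_pairCos hr ht
  simp_rw [inner_normalizedMatVec]
  refine ⟨(hZ.ae_matVec_ne_zero hr hu).and (hZ.ae_matVec_ne_zero hr hv), ?_, ?_, hsum⟩
  · have h := integrable_pairCos (ι := Fin r) (inner ℝ u v)
    rw [← hlaw.map_eq] at h
    exact h.comp_aemeasurable hlaw.aemeasurable
  · rw [← hint]
    exact hlaw.integral_comp measurable_pairCos.aestronglyMeasurable
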